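/- **Model and algorithm $\mathrm{AF}_{IF}$.** Let $G=(V,E)$ be a finite connected undirected simple graph and $b\ge 1$. Nodes run in synchronous rounds $0,1,2,\dots$; a message sent in a round is received in the next round. The local state of a node $v$ consists of a parity bit (arbitrary initial value, toggled at the end of every round) and a message table, initially empty. A row of the table belongs to a message $m$ (identified by its id) and has two entries, one for each parity; each entry is $\bot$ or a set of neighbours of $v$. A row with both entries $\bot$ is deleted. In each round with current parity $p$, node $v$ does the following. 1. For each message $m$ whose broadcast $v$ invokes in this round, it creates a row for $m$ with both entries $\emptyset$. Then, for each message $m$ received from a neighbour $w$ in this round, it adds $w$ to the entry of $m$ of parity $p$ (creating the row if necessary; $\bot$ is first replaced by $\emptyset$). Then every entry of parity $p$ that equals $N(v)$ is set to $\bot$. 2. Among the messages whose entry of parity $p$ is not $\bot$ (the eligible ones), $v$ selects $b$, or all of them if there are fewer than $b$. Each selected $m$ is sent to all neighbours of $v$ not listed in its entry of parity $p$. That entry is then set to $\bot$, and the row is deleted if its other entry is $\bot$ or $\emptyset$. In particular each node sends at most $b$ messages to each neighbour per round. The selection is fair: there is a fixed number $K$ such that, for every node $v$ and every message $m$, as long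 as $m$ is eligible at $v$ in consecutive rounds of one parity without being selected, $v$ makes at most $K$ selections in these rounds. **Theorem.** Consider any sequence of broadcasts (of identical or different messages) invoked by nodes of $G$ in arbitrary rounds, such that whenever a node invokes a broadcast of $m$, it has neither received $m$ nor invoked a broadcast of $m$ in an earlier round. Then in every execution of $\mathrm{AF}_{IF}$ the following holds for every message $m$ that is broadcast. * *Termination, without memorising receptions:* from some round on, $m$ is neither sent nor received, and no node has a row for $m$ in its table. * *Delivery:* every node that does not itself invoke a broadcast of $m$ receives $m$. * *Number of forwards:* let $F_m$ be the number of triples (round, sender, receiver) in which $m$ is sent. If $G$ is not bipartite, then $F_m=2|E|$. If $G$ is bipartite, then $F_m\in\{|E|,2|E|\}$, and $F_m=|E|$ if only one node broadcasts $m$. Moreover, if the total number of broadcasts is finite, then there is a round from which on no message is sent or received and all message tables are empty. -/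

import Mathlib

namespace AmnesiacFlooding

/-- A message table: `tbl m p` is the column of parity `p` in the row of message `m`, that is, the
set of recorded senders of `m`, or `none` for the symbol `⊥`. The table has no row for `m` exactly
when both columns are `none`. -/
abbrev Table (V Msg : Type*) := Msg → Bool → Option (Set V)

/-- The complete local state of a node: its parity flag and its message table. -/
structure NodeState (V Msg : Type*) where
  parity : Bool
  messTbl : Table V Msg

/-- The global state at the beginning of a round: the local states, and the messages that were
sent in the preceding round (`sent w v m`: node `w` sent `m` to `v`), received in this round. -/
structure Config (V Msg : Type*) where
  node : V → NodeState V Msg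
  sent : V → V → Msg → Prop

section Local

variable {V Msg : Type*}

open Classical in
/-- `broadcast(m)` for all `m ∈ B`: a new row with both columns equal to the empty list. -/
noncomputable def Table.invoke (tbl : Table V Msg) (B : Set Msg) : Table V Msg :=
  fun m q => if m ∈ B then some ∅ else tbl m q

open Classical in
/-- Every sender `w ∈ R m` of a received message `m` is added to the column of parity `p`
(where `⊥` is first replaced by the empty list). -/
noncomputable def Table.receive (tbl : Table V Msg) (p : Bool) (R : Msg → Set V) :
    Table V Msg :=
  fun m q => if q = p ∧ (R m).Nonempty then some ((tbl m q).getD ∅ ∪ R m) else tbl m q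

open Classical in
/-- Cleaning: entries of parity `p` that equal the set `N` of all neighbours become `⊥`. -/
noncomputable def Table.clean (tbl : Table V Msg) (p : Bool) (N : Set V) : Table V Msg :=
  fun m q => if q = p ∧ tbl m q = some N then none else tbl m q

open Classical in
/-- After sending the messages in `S` in a round of parity `p`: their entries of parity `p` become
`⊥`, and the row is deleted if its other entry is `⊥` or the empty list. -/
noncomputable def Table.discard (tbl : Table V Msg) (p : Bool) (S : Finset Msg) : Table V Msg :=
  fun m q => if m ∈ S ∧ (q = p ∨ tbl m q = some ∅) then none else tbl m q

end Local

section Global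

variable {V Msg : Type*} (G : SimpleGraph V)

/-- The table of node `v` after the first step of a round that starts in configuration `c`, where
`B` is the set of messages whose broadcast `v` invokes at the beginning of this round: invocation,
reception, cleaning. -/
noncomputable def readyTable (c : Config V Msg) (B : Set Msg) (v : V) : Table V Msg :=
  (((c.node v).messTbl.invoke B).receive (c.node v).parity (fun m => {w | c.sent w v m})).clean
    (c.node v).parity (G.neighborSet v)

/-- The messages that `v` may select in the round: the entry of the current parity is not `⊥`. -/
def eligible (c : Config V Msg) (B : Set Msg) (v : V) : Set Msg :=
  {m | readyTable G c B v m (c.node v).parity ≠ none}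

/-- In the round that starts in `c`, node `v` sends `m` to `w`, where `S` is the set of messages
that `v` selects: the selected messages go to all neighbours not listed in the current entry. -/
def sendsIn (c : Config V Msg) (B : Set Msg) (S : Finset Msg) (v w : V) (m : Msg) : Prop :=
  m ∈ S ∧ G.Adj v w ∧ ∃ L, readyTable G c B v m (c.node v).parity = some L ∧ w ∉ L

/-- One synchronous round. -/
noncomputable def step (B : V → Set Msg) (S : V → Finset Msg) (c : Config V Msg) :
    Config V Msg where
  node v :=
    { parity := !(c.node v).parity
      messTbl := (readyTable G c (B v) v).discard (c.node v).parity (S v) }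
  sent v w m := sendsIn G c (B v) (S v) v w m

/-- The configuration at the beginning of each round `0, 1, 2, …`, given the initial parity flags,
the messages `B r v` whose broadcast node `v` invokes in round `r`, and the messages `S r v`
that node `v` selects in round `r`. Initially all tables are empty and nothing is in transit. -/
noncomputable def run (par : V → Bool) (B : ℕ → V → Set Msg) (S : ℕ → V → Finset Msg) :
    ℕ → Config V Msg
  | 0 => { node := fun v => { parity := par v, messTbl := fun _ _ => none }
           sent := fun _ _ _ => False }
  | r + 1 => step G (B r) (S r) (run par B S r)

variable (par : V → Bool) (B : ℕ → V → Set Msg) (S : ℕ → V → Finset Msg)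

/-- The messages among which node `v` selects in round `r`. -/
def eligibleAt (r : ℕ) (v : V) : Set Msg :=
  eligible G (run G par B S r) (B r v) v

/-- Node `v` sends `m` to `w` in round `r`. -/
def sendsAt (r : ℕ) (v w : V) (m : Msg) : Prop :=
  sendsIn G (run G par B S r) (B r v) (S r v) v w m

/-- Node `v` receives `m` (from some neighbour) in round `r`. -/
def receivesAt (r : ℕ) (v : V) (m : Msg) : Prop :=
  ∃ w, (run G par B S r).sent w v m

/-- In each round each node selects up to `b` eligible messages: `b` of them if there are that
many, and otherwise all of them. -/
structure IsSelection (b : ℕ) : Prop where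
  subset : ∀ r v, (S r v : Set Msg) ⊆ eligibleAt G par B S r v
  card_le : ∀ r v, (S r v).card ≤ b
  maximal : ∀ r v, (S r v).card < b → eligibleAt G par B S r v ⊆ (S r v : Set Msg)

/-- Fairness: there is a fixed number `K` such that a node makes at most `K` selections while it
passes over an eligible message. An entry is eligible only in rounds of its own parity, so the
rounds in which it is passed over are `r, r + 2, …, r + 2 * t`. -/
def IsFair : Prop :=
  ∃ K : ℕ, ∀ (v : V) (m : Msg) (r t : ℕ),
    (∀ j ≤ t, m ∈ eligibleAt G par B S (r + 2 * j) v ∧ m ∉ S (r + 2 * j) v) →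
      ∑ j ∈ Finset.range (t + 1), (S (r + 2 * j) v).card ≤ K

/-- A broadcast of `m` is invoked by a node only before `m` has reached it, that is, the node has
neither received `m` nor itself invoked a broadcast of `m` in an earlier round. -/
def InvokedBeforeReached : Prop :=
  ∀ (m : Msg) (v : V) (r : ℕ), m ∈ B r v →
    ∀ s < r, m ∉ B s v ∧ ¬ receivesAt G par B S s v m

/-- From round `T` on, `m` is neither sent nor received, and no node has a row for `m`. -/
def QuietFrom (T : ℕ) (m : Msg) : Prop :=
  ∀ r ≥ T, ∀ v, (∀ w, ¬ sendsAt G par B S r v w m) ∧ ¬ receivesAt G par B S r v m ∧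
    ∀ q, ((run G par B S r).node v).messTbl m q = none

/-- Every node that does not itself broadcast `m` receives `m`. -/
def Delivered (m : Msg) : Prop :=
  ∀ v, (∀ r, m ∉ B r v) → ∃ r, receivesAt G par B S r v m

/-- The number of times that `m` is forwarded: the number of triples (round, sender, receiver). -/
noncomputable def forwardCount (m : Msg) : ℕ∞ :=
  {x : ℕ × V × V | sendsAt G par B S x.1 x.2.1 x.2.2 m}.encard

end Global

end AmnesiacFlooding

/-! Messages interact only through the selections, so each message can be followed alone; fairness
guarantees only that no entry waits forever. The natural setting is the bipartite double cover of
`G`: a send from `v` to `w` in round `r` crosses the edge between `(v, r mod 2)` and `(w, r+1 mod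
2)`.

The invariant `consistent_entry` says that the entry of `(v, q)` records exactly the used cover
edges at `(v, q)`, apart from those just being delivered; `⊥` means that none or all of them are
used. Since a node sends only to unlisted neighbours, each cover edge is crossed at most once
(`injOn_crossing`). Hence sends are finite in number, and with fairness everything falls silent
(`exists_quiet`).

In the final silence every entry is `⊥`, so a cover node has none or all of its edges used
(`exists_used_of_adj`): the used edges form a union of components. As `G` is connected, they reach a
copy of every node, which gives delivery. If both copies of some node are touched, all `2|E|` cover
edges are used; otherwise the touched copies of even parity form one side of a bipartition and
exactly `|E|` edges are used. With one broadcaster and `G` bipartite, the first send deletes the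
other empty entry, so only one component is ever entered (`sends_class`). -/

namespace AmnesiacFlooding

/-! ### Single-message histories and used edges of the double cover -/

variable {V : Type*}

/-- The history of a single message: `entry r v q` is the entry that node `v` holds at the beginning
of round `r` for rounds of parity `q`, `inbox r v` the set of nodes from which `v` receives the
message in round `r`. -/
structure MessageTrace (V : Type*) where
  entry : ℕ → V → Bool → Option (Set V)
  inbox : ℕ → V → Set V
  invoked : ℕ → V → Prop
  selected : ℕ → V → Prop

namespace MessageTrace

variable (M : MessageTrace V) (G : SimpleGraph V)

open Classical in
/-- The entry after the invocations of a round. -/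
noncomputable def opened (r : ℕ) (v : V) (q : Bool) : Option (Set V) :=
  if M.invoked r v then some ∅ else M.entry r v q

open Classical in
/-- The entry of the current parity after the receptions of a round. -/
noncomputable def received (r : ℕ) (v : V) : Option (Set V) :=
  if (M.inbox r v).Nonempty then some ((M.opened r v r.bodd).getD ∅ ∪ M.inbox r v)
  else M.opened r v r.bodd

open Classical in
/-- The entry of the current parity after cleaning. -/
noncomputable def ready (r : ℕ) (v : V) : Option (Set V) :=
  if M.received r v = some (G.neighborSet v) then none else M.received r v

/-- Node `v` sends the message to `w` in round `r`. -/
def sends (r : ℕ) (v w : V) : Prop :=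
  M.selected r v ∧ G.Adj v w ∧ ∃ L, M.ready G r v = some L ∧ w ∉ L

open Classical in
/-- The laws obeyed by the history of a message in an execution of the algorithm. -/
structure IsExecution : Prop where
  entry_zero : ∀ v q, M.entry 0 v q = none
  inbox_zero : ∀ v, M.inbox 0 v = ∅
  entry_current : ∀ r v,
    M.entry (r + 1) v r.bodd = if M.selected r v then none else M.ready G r v
  entry_other : ∀ r v, M.entry (r + 1) v (!r.bodd) =
    if M.selected r v ∧ M.opened r v (!r.bodd) = some ∅ then none else M.opened r v (!r.bodd)
  inbox_succ : ∀ r v, M.inbox (r + 1) v = {w | M.sends G r w v}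
  ready_of_selected : ∀ r v, M.selected r v → M.ready G r v ≠ none
  invoked_fresh : ∀ r v, M.invoked r v → ∀ s < r, ¬ M.invoked s v ∧ M.inbox s v = ∅
  progress : ∀ r v, ∃ j, M.selected (r + 2 * j) v ∨ M.ready G (r + 2 * j) v = none

/-- Before round `r`, the message has crossed the edge between `(v, q)` and `(w, !q)` of the
bipartite double cover, in one direction or the other. -/
def used (r : ℕ) (v : V) (q : Bool) (w : V) : Prop :=
  ∃ s < r, (s.bodd = q ∧ M.sends G s v w) ∨ (s.bodd = !q ∧ M.sends G s w v)

/-- The nodes from which the copy `(v, q)` of `v` in the double cover receives in round `r`. -/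
def arriving (r : ℕ) (v : V) (q : Bool) : Set V := {w | q = r.bodd ∧ w ∈ M.inbox r v}

variable {M G}

theorem sends.adj {r v w} (h : M.sends G r v w) : G.Adj v w := h.2.1

theorem used_symm {r v q w} : M.used G r v q w ↔ M.used G r w (!q) v := by
  unfold used
  constructor <;> rintro ⟨s, hs, h⟩ <;> refine ⟨s, hs, ?_⟩ <;> simpa [or_comm] using h

theorem used_mono {r s v q w} (hrs : r ≤ s) (h : M.used G r v q w) : M.used G s v q w := by
  obtain ⟨t, ht, h⟩ := h
  exact ⟨t, by omega, h⟩

theorem used.adj {r v q w} (h : M.used G r v q w) : G.Adj v w := by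
  obtain ⟨s, _, ⟨_, h⟩ | ⟨_, h⟩⟩ := h
  exacts [h.adj, h.adj.symm]

theorem used_succ {r v q w} : M.used G (r + 1) v q w ↔
    M.used G r v q w ∨ (r.bodd = q ∧ M.sends G r v w) ∨ (r.bodd = !q ∧ M.sends G r w v) := by
  unfold used
  constructor
  · rintro ⟨s, hs, h⟩
    rcases Nat.lt_succ_iff_lt_or_eq.mp hs with hs | rfl
    exacts [.inl ⟨s, hs, h⟩, .inr h]
  · rintro (⟨s, hs, h⟩ | h)
    exacts [⟨s, by omega, h⟩, ⟨r, by omega, h⟩]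

namespace IsExecution

/-! ### Nodes the message has not reached -/

theorem ready_eq_none_of_fresh {r v} (he : ∀ q, M.entry r v q = none) (hi : ¬ M.invoked r v)
    (hb : M.inbox r v = ∅) : M.ready G r v = none := by
  simp [ready, received, opened, he, hi, hb]

theorem entry_succ_cases (h : M.IsExecution G) {r v q} (hne : M.entry (r + 1) v q ≠ none) :
    (q = r.bodd ∧ M.entry (r + 1) v q = M.ready G r v) ∨
      (q = !r.bodd ∧ M.entry (r + 1) v q = M.opened r v q) := by
  by_cases hq : q = r.bodd
  · subst hq
    have := h.entry_current r v
    split_ifs at this with hs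
    · exact absurd this hne
    · exact .inl ⟨rfl, this⟩
  · obtain rfl : q = !r.bodd := by revert hq; cases q <;> cases r.bodd <;> simp
    have := h.entry_other r v
    split_ifs at this with hs
    · exact absurd this hne
    · exact .inr ⟨rfl, this⟩

theorem entry_eq_none_of_fresh (h : M.IsExecution G) {r v}
    (hf : ∀ s < r, ¬ M.invoked s v ∧ M.inbox s v = ∅) (q : Bool) : M.entry r v q = none := by
  induction r generalizing q with
  | zero => exact h.entry_zero v q
  | succ r ih =>
    have ih := ih fun s hs => hf s (by omega)
    obtain ⟨hi, hb⟩ := hf r (by omega)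
    by_contra hne
    rcases h.entry_succ_cases hne with ⟨-, he⟩ | ⟨-, he⟩
    · exact hne (he.trans (ready_eq_none_of_fresh ih hi hb))
    · exact hne (he.trans (by simp [opened, hi, ih]))

theorem not_sends_of_fresh (h : M.IsExecution G) {r v w}
    (hf : ∀ s ≤ r, ¬ M.invoked s v ∧ M.inbox s v = ∅) : ¬ M.sends G r v w := by
  rintro ⟨-, -, L, hL, -⟩
  obtain ⟨hi, hb⟩ := hf r le_rfl
  rw [ready_eq_none_of_fresh (h.entry_eq_none_of_fresh fun s hs => hf s hs.le) hi hb] at hL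
  cases hL

/-- A fresh node has sent nothing and received nothing earlier, so its only used edges are those
delivering in this very round. Resetting both entries to `∅` on invocation therefore loses no
information. -/
theorem used_iff_arriving_of_invoked (h : M.IsExecution G) {r v} (hi : M.invoked r v) (q : Bool) :
    {w | M.used G r v q w} = M.arriving r v q := by
  have hf := h.invoked_fresh r v hi
  ext w
  simp only [used, arriving, Set.mem_ofPred_eq]
  constructor
  · rintro ⟨s, hs, ⟨-, hw⟩ | ⟨hsq, hw⟩⟩
    · exact absurd hw (h.not_sends_of_fresh fun t ht => hf t (by omega))
    · have hmem : w ∈ M.inbox (s + 1) v := by rw [h.inbox_succ]; exact hw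
      obtain rfl | hlt : s + 1 = r ∨ s + 1 < r := by omega
      · exact ⟨by simp [hsq], hmem⟩
      · simp [(hf _ hlt).2] at hmem
  · rintro ⟨hq, hw⟩
    cases r with
    | zero => simp [h.inbox_zero] at hw
    | succ r =>
      rw [h.inbox_succ] at hw
      exact ⟨r, by omega, .inr ⟨by simp [hq], hw⟩⟩

/-! ### The invariant: entries record used edges -/

/-- The entry `e` of a node of the double cover with neighbourhood `N`, edges in `A` being just in
use for delivery, agrees with the set `U` of its used edges. -/
def Consistent (e : Option (Set V)) (U A N : Set V) : Prop :=
  (e = none ∧ (U = A ∨ U = N ∧ A = ∅)) ∨ ∃ L, e = some L ∧ U = L ∪ A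

theorem consistent_opened (h : M.IsExecution G) {r v q}
    (hc : Consistent (M.entry r v q) {w | M.used G r v q w} (M.arriving r v q) (G.neighborSet v)) :
    Consistent (M.opened r v q) {w | M.used G r v q w} (M.arriving r v q) (G.neighborSet v) := by
  unfold opened
  split_ifs with hi
  · exact .inr ⟨∅, rfl, by simp [h.used_iff_arriving_of_invoked hi]⟩
  · exact hc

/-- Reception moves the arriving edges into the record, so none remain pending; cleaning turns a
full record into `⊥`, the saturated alternative of the invariant. -/
theorem consistent_ready (h : M.IsExecution G) {r v}
    (hc : ∀ q, Consistent (M.entry r v q) {w | M.used G r v q w} (M.arriving r v q)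
      (G.neighborSet v)) :
    Consistent (M.ready G r v) {w | M.used G r v r.bodd w} ∅ (G.neighborSet v) ∧
      M.ready G r v ≠ some (G.neighborSet v) := by
  have hA : M.arriving r v r.bodd = M.inbox r v := by ext; simp [arriving]
  have hc := h.consistent_opened (hc r.bodd)
  rw [hA] at hc
  have hr : Consistent (M.received r v) {w | M.used G r v r.bodd w} ∅ (G.neighborSet v) := by
    unfold received
    split_ifs with hb
    · rcases hc with ⟨he, hU | ⟨-, hU⟩⟩ | ⟨L, he, hU⟩
      · exact .inr ⟨_, rfl, by simp [he, hU]⟩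
      · simp [hU] at hb
      · exact .inr ⟨_, rfl, by simp [he, hU]⟩
    · rwa [Set.not_nonempty_iff_eq_empty.mp hb] at hc
  unfold ready
  split_ifs with hN
  · refine ⟨.inl ⟨rfl, ?_⟩, by simp⟩
    rcases hr with ⟨he, -⟩ | ⟨L, he, hU⟩
    · simp [he] at hN
    · rw [he, Option.some_inj] at hN
      exact .inr ⟨by simpa [hN] using hU, rfl⟩
  · exact ⟨hr, hN⟩

theorem consistent_entry (h : M.IsExecution G) (r : ℕ) : ∀ v q,
    Consistent (M.entry r v q) {w | M.used G r v q w} (M.arriving r v q) (G.neighborSet v) := by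
  induction r with
  | zero =>
    intro v q
    exact .inl ⟨h.entry_zero v q, .inl (by ext; simp [used, arriving, h.inbox_zero])⟩
  | succ r ih =>
    intro v q
    by_cases hq : q = r.bodd
    · subst hq
      have hA : M.arriving (r + 1) v r.bodd = ∅ := by ext; simp [arriving]
      have hr := (h.consistent_ready (ih v)).1
      rw [hA, h.entry_current]
      split_ifs with hs
      · obtain ⟨L, hL⟩ := Option.ne_none_iff_exists'.mp (h.ready_of_selected r v hs)
        refine .inl ⟨rfl, .inr ⟨?_, rfl⟩⟩
        have hU : {w | M.used G r v r.bodd w} = L := by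
          rcases hr with ⟨he, -⟩ | ⟨L', he, hU⟩
          · simp [he] at hL
          · rw [hL, Option.some_inj] at he
            simp [he, hU]
        ext w
        -- Sending to every unlisted neighbour saturates the node: listed edges were used before,
        -- the others are used now.
        refine ⟨fun hw => used.adj hw, fun hw => ?_⟩
        simp only [Set.mem_ofPred_eq, used_succ]
        by_cases hwL : w ∈ L
        · rw [← hU] at hwL
          exact .inl hwL
        · exact .inr (.inl ⟨by simp, hs, hw, L, hL, hwL⟩)
      · convert hr using 1
        ext w
        simp [used_succ, sends, hs]
    · obtain rfl : q = !r.bodd := by revert hq; cases q <;> cases r.bodd <;> simp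
      have hA0 : M.arriving r v (!r.bodd) = ∅ := by ext; simp [arriving]
      have hA : M.arriving (r + 1) v (!r.bodd) = {w | M.sends G r w v} := by
        ext; simp [arriving, h.inbox_succ]
      have hU : {w | M.used G (r + 1) v (!r.bodd) w} =
          {w | M.used G r v (!r.bodd) w} ∪ {w | M.sends G r w v} := by
        ext w; simp [used_succ]
      have ho := h.consistent_opened (ih v (!r.bodd))
      rw [hA0] at ho
      rw [hA, hU, h.entry_other]
      rcases ho with ⟨he, hU | ⟨hU, -⟩⟩ | ⟨L, he, hU⟩
      · exact .inl ⟨by simp [he], .inl (by simp [hU])⟩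
      · refine .inl ⟨by simp [he], .inr ?_⟩
        -- All edges at this copy of `v` are used, so the ready entry of each neighbour already
        -- lists `v`.
        have hno : {w | M.sends G r w v} = ∅ := by
          refine Set.eq_empty_of_forall_notMem fun w hw => ?_
          have hwN : w ∈ G.neighborSet v := hw.adj.symm
          rw [← hU] at hwN
          obtain ⟨-, -, L, hL, hvL⟩ := hw
          rcases (h.consistent_ready (ih w)).1 with ⟨he, -⟩ | ⟨L', he, hU'⟩
          · simp [he] at hL
          · rw [hL, Option.some_inj] at he
            refine hvL ?_
            rw [he, ← Set.union_empty L', ← hU']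
            have := used_symm.mp hwN
            rwa [Bool.not_not] at this
        simp [hU, hno]
      · split_ifs with hs
        · rw [he, Option.some_inj] at hs
          -- Deleting an empty entry is harmless: the used edges are then only those being delivered
          -- next.
          exact .inl ⟨rfl, .inl (by simp [hU, hs.2])⟩
        · exact .inr ⟨L, he, by simp [hU]⟩

theorem not_used_of_sends (h : M.IsExecution G) {r v w} (hs : M.sends G r v w) :
    ¬ M.used G r v r.bodd w := by
  obtain ⟨-, -, L, hL, hwL⟩ := hs
  rcases (h.consistent_ready (h.consistent_entry r v)).1 with ⟨he, -⟩ | ⟨L', he, hU⟩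
  · simp [he] at hL
  · rw [hL, Option.some_inj] at he
    intro hu
    apply hwL
    rw [he, ← Set.union_empty L', ← hU]
    exact hu

/-! ### Each edge is crossed at most once; termination -/

/-- The edge of the double cover crossed by a send, directed from its copy of even parity. -/
def crossing (x : ℕ × V × V) : V × V := if x.1.bodd then (x.2.2, x.2.1) else x.2

theorem used_crossing_iff {t r v w} : M.used G t (crossing (r, v, w)).1 false
    (crossing (r, v, w)).2 ↔ M.used G t v r.bodd w := by
  cases hr : r.bodd
  · simp [crossing, hr]
  · simp only [crossing, hr, if_true]
    exact used_symm

/-- Of two sends across the same cover edge, the earlier would make the edge used at the time of the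
later, against `not_used_of_sends`. -/
theorem injOn_crossing (h : M.IsExecution G) :
    Set.InjOn crossing {x : ℕ × V × V | M.sends G x.1 x.2.1 x.2.2} := by
  have key : ∀ r v w s v' w', M.sends G r v w → M.sends G s v' w' →
      crossing (r, v, w) = crossing (s, v', w') → ¬ r < s := by
    intro r v w s v' w' h₁ h₂ he hrs
    refine h.not_used_of_sends h₂ (used_crossing_iff.mp ?_)
    rw [← he]
    exact used_crossing_iff.mpr ⟨r, hrs, .inl ⟨rfl, h₁⟩⟩
  rintro ⟨r, v, w⟩ h₁ ⟨s, v', w'⟩ h₂ he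
  obtain rfl : r = s := by
    have := key _ _ _ _ _ _ h₁ h₂ he
    have := key _ _ _ _ _ _ h₂ h₁ he.symm
    omega
  cases hr : r.bodd <;> simp_all [crossing]

theorem finite_sends [Finite V] (h : M.IsExecution G) :
    {x : ℕ × V × V | M.sends G x.1 x.2.1 x.2.2}.Finite :=
  Set.Finite.of_injOn (Set.mapsTo_univ _ _) h.injOn_crossing Set.finite_univ

theorem finite_invoked [Finite V] (h : M.IsExecution G) :
    {x : ℕ × V | M.invoked x.1 x.2}.Finite := by
  refine Set.Finite.of_injOn (f := Prod.snd) (Set.mapsTo_univ _ _) ?_ Set.finite_univ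
  rintro ⟨r, v⟩ h₁ ⟨s, w⟩ h₂ (rfl : v = w)
  rcases lt_trichotomy r s with hrs | rfl | hrs
  · exact absurd h₁ (h.invoked_fresh s v h₂ r hrs).1
  · rfl
  · exact absurd h₂ (h.invoked_fresh r v h₁ s hrs).1

theorem entry_succ_eq_none (h : M.IsExecution G) {r v q} (hi : ¬ M.invoked r v)
    (hb : M.inbox r v = ∅) (he : M.entry r v q = none) : M.entry (r + 1) v q = none := by
  by_contra hne
  rcases h.entry_succ_cases hne with ⟨rfl, he'⟩ | ⟨-, he'⟩
  · exact hne (he'.trans (by simp [ready, received, opened, hi, hb, he]))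
  · exact hne (he'.trans (by simp [opened, hi, he]))

/-- After the last send and the last invocation an entry `⊥` stays `⊥`, and progress turns every
entry into `⊥` eventually. -/
theorem exists_quiet [Finite V] (h : M.IsExecution G) : ∃ T, ∀ r ≥ T, ∀ v,
    (∀ w, ¬ M.sends G r v w) ∧ M.inbox r v = ∅ ∧ ∀ q, M.entry r v q = none := by
  obtain ⟨T₁, hT₁⟩ := (h.finite_sends.image Prod.fst).bddAbove
  obtain ⟨T₂, hT₂⟩ := (h.finite_invoked.image Prod.fst).bddAbove
  have hsend : ∀ r > T₁, ∀ v w, ¬ M.sends G r v w := fun r hr v w hs =>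
    absurd (hT₁ ⟨(r, v, w), hs, rfl⟩) (not_le.mpr hr)
  have hinv : ∀ r > T₂, ∀ v, ¬ M.invoked r v := fun r hr v hs =>
    absurd (hT₂ ⟨(r, v), hs, rfl⟩) (not_le.mpr hr)
  have hbox : ∀ r > T₁ + 1, ∀ v, M.inbox r v = ∅ := by
    intro r hr v
    obtain ⟨r, rfl⟩ : ∃ k, r = k + 1 := ⟨r - 1, by omega⟩
    rw [h.inbox_succ]
    exact Set.eq_empty_of_forall_notMem fun w hw => hsend r (by omega) w v hw
  have hstay : ∀ v q r, T₁ + T₂ + 2 ≤ r → M.entry r v q = none →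
      ∀ s ≥ r, M.entry s v q = none := by
    intro v q r hr he s hs
    induction s, hs using Nat.le_induction with
    | base => exact he
    | succ s hs ih =>
      exact h.entry_succ_eq_none (hinv s (by omega) v) (hbox s (by omega) v) ih
  have hex : ∀ x : V × Bool, ∃ r, ∀ s ≥ r, M.entry s x.1 x.2 = none := by
    rintro ⟨v, q⟩
    -- Only rounds of parity `q` can select from column `q`, so the late starting round is chosen
    -- with that parity.
    obtain ⟨r, hr, rfl⟩ : ∃ r, T₁ + T₂ + 2 ≤ r ∧ r.bodd = q := by
      by_cases hq : (T₁ + T₂ + 2).bodd = q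
      · exact ⟨_, le_rfl, hq⟩
      · refine ⟨T₁ + T₂ + 2 + 1, by omega, ?_⟩
        rw [Nat.bodd_succ]
        revert hq
        cases q <;> cases (T₁ + T₂ + 2).bodd <;> simp
    obtain ⟨j, hj⟩ := h.progress r v
    refine ⟨r + 2 * j + 1, hstay _ _ _ (by omega) ?_⟩
    have hp : (r + 2 * j).bodd = r.bodd := by simp
    have := h.entry_current (r + 2 * j) v
    rw [hp] at this
    rw [this]
    rcases hj with hj | hj <;> simp [hj]
  choose R hR using hex
  obtain ⟨T₃, hT₃⟩ := (Set.finite_range R).bddAbove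
  refine ⟨T₁ + 2 + T₃, fun r hr v => ⟨hsend r (by omega) v, hbox r (by omega) v, fun q => ?_⟩⟩
  have : R (v, q) ≤ T₃ := hT₃ ⟨_, rfl⟩
  exact hR (v, q) r (by omega)

/-! ### Saturation of components and delivery -/

theorem used_of_sends {r v w} (hs : M.sends G r v w) : M.used G (r + 1) v r.bodd w :=
  ⟨r, by omega, .inl ⟨rfl, hs⟩⟩

/-- In the final silence the entry is `⊥` and nothing is arriving, so the invariant leaves only "no
edge used" or "all edges used". -/
theorem exists_used_of_adj [Finite V] (h : M.IsExecution G) {r v q w u} (hu : M.used G r v q w)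
    (hvu : G.Adj v u) : ∃ s, M.used G s v q u := by
  obtain ⟨T, hT⟩ := h.exists_quiet
  obtain ⟨-, hb, he⟩ := hT (max r T) (le_max_right _ _) v
  have hw : w ∈ {w | M.used G (max r T) v q w} := used_mono (le_max_left _ _) hu
  have hA : M.arriving (max r T) v q = ∅ := by simp [arriving, hb]
  rcases h.consistent_entry (max r T) v q with ⟨-, hU | ⟨hU, -⟩⟩ | ⟨L, hL, -⟩
  · rw [hU, hA] at hw
    exact hw.elim
  · exact ⟨max r T, by change u ∈ {w | M.used G (max r T) v q w}; rw [hU]; exact hvu⟩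
  · simp [he] at hL

/-- Without any send, the empty entries created by the invocation would persist forever, since `∅`
is not the full neighbourhood and is not cleaned; this contradicts `exists_quiet`. -/
theorem exists_sends [Finite V] (h : M.IsExecution G) {r v w} (hi : M.invoked r v)
    (hvw : G.Adj v w) : ∃ s x y, M.sends G s x y := by
  by_contra! hno
  have hbox : ∀ s v, M.inbox s v = ∅ := by
    rintro (_ | s) v
    · exact h.inbox_zero v
    · rw [h.inbox_succ]
      exact Set.eq_empty_of_forall_notMem fun w hw => hno _ _ _ hw
  have hN : (∅ : Set V) ≠ G.neighborSet v := fun he => by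
    have : w ∈ G.neighborSet v := hvw
    simp [← he] at this
  have key : ∀ s, (∀ q, M.opened s v q = some ∅) → ∀ q, M.entry (s + 1) v q = some ∅ := by
    intro s ho
    have hr : M.ready G s v = some ∅ := by simp [ready, received, hbox, ho, hN]
    have hns : ¬ M.selected s v := fun hs => hno s v w ⟨hs, hvw, ∅, hr, by simp⟩
    have h₁ := h.entry_current s v
    have h₂ := h.entry_other s v
    simp only [hns, false_and, if_false, hr, ho] at h₁ h₂
    intro q
    cases q <;> cases hs : s.bodd <;> simp_all
  have hall : ∀ s ≥ r + 1, ∀ q, M.entry s v q = some ∅ := by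
    intro s hs
    induction s, hs using Nat.le_induction with
    | base => exact key r fun q => by simp [opened, hi]
    | succ s hs ih =>
      refine key s fun q => ?_
      unfold opened
      split_ifs
      exacts [rfl, ih q]
  obtain ⟨T, hT⟩ := h.exists_quiet
  have h₁ := (hT (max T (r + 1)) (le_max_left _ _) v).2.2 true
  rw [hall _ (le_max_right _ _)] at h₁
  cases h₁

/-- In a connected graph, every node is incident with a used edge of the double cover, as soon as
the message is sent at all. -/
theorem exists_used [Finite V] (hG : G.Connected) (h : M.IsExecution G) {r x y}
    (hs : M.sends G r x y) (v : V) : ∃ q s w, M.used G s v q w := by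
  have walk : ∀ (a c : V) (p : G.Walk a c), (∃ q s w, M.used G s a q w) →
      ∃ q s w, M.used G s c q w := by
    intro a c p
    induction p with
    | nil => exact id
    | cons hab p ih =>
      rintro ⟨q, s, w, hu⟩
      obtain ⟨t, ht⟩ := h.exists_used_of_adj hu hab
      exact ih ⟨_, _, _, used_symm.mp ht⟩
  obtain ⟨p⟩ := hG.preconnected x v
  exact walk _ _ p ⟨_, _, _, used_of_sends hs⟩

theorem exists_inbox_nonempty [Finite V] (hG : G.Connected) (h : M.IsExecution G) {r x}
    (hx : M.invoked r x) {v : V} (hv : ∀ r, ¬ M.invoked r v) : ∃ r, (M.inbox r v).Nonempty := by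
  by_contra! hno
  have hxv : x ≠ v := fun he => hv r (he ▸ hx)
  have : Nontrivial V := ⟨x, v, hxv⟩
  obtain ⟨w, hw⟩ := hG.preconnected.exists_adj_of_nontrivial x
  obtain ⟨s, y, z, hs⟩ := h.exists_sends hx hw
  -- A used edge at `v` was crossed outwards, impossible for a fresh node, or inwards, which is a
  -- reception.
  obtain ⟨q, t, u, k, -, ⟨-, hk⟩ | ⟨-, hk⟩⟩ := h.exists_used hG hs v
  · exact h.not_sends_of_fresh (fun s _ => ⟨hv s, hno s⟩) hk
  · have := hno (k + 1)
    rw [h.inbox_succ] at this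
    exact (this ▸ hk : u ∈ (∅ : Set V))

end IsExecution

end MessageTrace

end AmnesiacFlooding

/-! ### Counting the forwards -/

namespace AmnesiacFlooding

variable {V : Type*} {G : SimpleGraph V}

theorem encard_adj_eq_two_mul [Finite V] (G : SimpleGraph V) :
    {p : V × V | G.Adj p.1 p.2}.encard = 2 * G.edgeSet.encard := by
  classical
  have := Fintype.ofFinite V
  have h₁ : {p : V × V | G.Adj p.1 p.2}.encard = Fintype.card G.Dart := by
    have hr : {p : V × V | G.Adj p.1 p.2} = Set.range (SimpleGraph.Dart.toProd (G := G)) := by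
      ext p
      exact ⟨fun hp => ⟨⟨p, hp⟩, rfl⟩, by rintro ⟨d, rfl⟩; exact d.adj⟩
    rw [hr, ← Set.image_univ, (SimpleGraph.Dart.toProd_injective (G := G)).encard_image,
      Set.encard_univ]
    simp
  rw [h₁, G.dart_card_eq_twice_card_edges, ← SimpleGraph.coe_edgeFinset,
    Set.encard_coe_eq_coe_finsetCard]
  push_cast
  rfl

theorem encard_adj_of_bipartition (A : Set V) (hA : ∀ v w, G.Adj v w → (v ∈ A ↔ w ∉ A)) :
    {p : V × V | G.Adj p.1 p.2 ∧ p.1 ∈ A}.encard = G.edgeSet.encard := by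
  have hinj : Set.InjOn (fun p : V × V => s(p.1, p.2)) {p | G.Adj p.1 p.2 ∧ p.1 ∈ A} := by
    rintro ⟨v, w⟩ ⟨hvw, hv⟩ ⟨v', w'⟩ ⟨-, hv'⟩ he
    rcases Sym2.eq_iff.mp he with ⟨h₁, h₂⟩ | ⟨h₁, h₂⟩
    · exact Prod.ext h₁ h₂
    · exact absurd (h₂ ▸ hv') ((hA _ _ hvw).mp hv)
  rw [← hinj.encard_image]
  congr 1
  ext e
  induction e with
  | _ v w =>
    rw [SimpleGraph.mem_edgeSet]
    constructor
    · rintro ⟨⟨x, y⟩, ⟨hxy, -⟩, he⟩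
      exact (SimpleGraph.mem_edgeSet G).mp (he ▸ (SimpleGraph.mem_edgeSet G).mpr hxy)
    · intro hvw
      by_cases hv : v ∈ A
      · exact ⟨(v, w), ⟨hvw, hv⟩, rfl⟩
      · exact ⟨(w, v), ⟨hvw.symm, (hA _ _ hvw.symm).mpr hv⟩, Sym2.eq_swap⟩

namespace MessageTrace

variable {M : MessageTrace V}

/-- The nodes whose copy `(v, q)` in the double cover is incident with a used edge. -/
def touched (M : MessageTrace V) (G : SimpleGraph V) (q : Bool) : Set V :=
  {v | ∃ s w, M.used G s v q w}

namespace IsExecution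

theorem mem_touched_of_adj [Finite V] (h : M.IsExecution G) {q v w} (hv : v ∈ M.touched G q)
    (hvw : G.Adj v w) : w ∈ M.touched G (!q) := by
  obtain ⟨s, u, hu⟩ := hv
  obtain ⟨t, ht⟩ := h.exists_used_of_adj hu hvw
  exact ⟨t, v, used_symm.mp ht⟩

/-- By saturation, the crossed edges are exactly those at touched copies of even parity; each cover
edge has one end of even parity, so each is counted once. -/
theorem image_crossing [Finite V] (h : M.IsExecution G) :
    crossing '' {x : ℕ × V × V | M.sends G x.1 x.2.1 x.2.2} =
      {p | G.Adj p.1 p.2 ∧ p.1 ∈ M.touched G false} := by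
  ext ⟨v, w⟩
  constructor
  · rintro ⟨⟨r, x, y⟩, hs, he⟩
    have hu := used_crossing_iff.mpr (used_of_sends (M := M) hs)
    rw [he] at hu
    exact ⟨hu.adj, _, _, hu⟩
  · rintro ⟨hvw, s, u, hu⟩
    obtain ⟨t, r, -, ⟨hr, hs⟩ | ⟨hr, hs⟩⟩ := h.exists_used_of_adj hu hvw
    · exact ⟨(r, v, w), hs, by simp [crossing, hr]⟩
    · exact ⟨(r, w, v), hs, by simp [crossing, hr]⟩

theorem encard_sends [Finite V] (h : M.IsExecution G) :
    {x : ℕ × V × V | M.sends G x.1 x.2.1 x.2.2}.encard =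
      {p : V × V | G.Adj p.1 p.2 ∧ p.1 ∈ M.touched G false}.encard := by
  rw [← h.image_crossing, h.injOn_crossing.encard_image]

theorem touched_cover [Finite V] (hG : G.Connected) (h : M.IsExecution G) {r x y}
    (hs : M.sends G r x y) (v : V) : v ∈ M.touched G false ∨ v ∈ M.touched G true := by
  obtain ⟨q, s, w, hu⟩ := h.exists_used hG hs v
  cases q
  exacts [.inl ⟨s, w, hu⟩, .inr ⟨s, w, hu⟩]

/-- Adjacent nodes are touched in opposite parities and every node in at least one, so disjointness
makes the even-touched nodes one side of a bipartition. -/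
theorem encard_sends_of_disjoint [Finite V] (hG : G.Connected) (h : M.IsExecution G) {r x y}
    (hs : M.sends G r x y) (hd : ∀ v ∈ M.touched G false, v ∉ M.touched G true) :
    (∀ v w, G.Adj v w → (v ∈ M.touched G false ↔ w ∉ M.touched G false)) ∧
      {x : ℕ × V × V | M.sends G x.1 x.2.1 x.2.2}.encard = G.edgeSet.encard := by
  have hA : ∀ v w, G.Adj v w → (v ∈ M.touched G false ↔ w ∉ M.touched G false) := by
    intro v w hvw
    refine ⟨fun hv hw => hd w hw (h.mem_touched_of_adj hv hvw), fun hw => ?_⟩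
    exact h.mem_touched_of_adj ((h.touched_cover hG hs w).resolve_left hw) hvw.symm
  exact ⟨hA, by rw [h.encard_sends, encard_adj_of_bipartition _ hA]⟩

theorem touched_eq_univ [Finite V] (hG : G.Connected) (h : M.IsExecution G) {x}
    (hx : x ∈ M.touched G false) (hx' : x ∈ M.touched G true) (v : V) :
    v ∈ M.touched G false := by
  have walk : ∀ (a c : V) (p : G.Walk a c), (∀ q, a ∈ M.touched G q) → ∀ q, c ∈ M.touched G q := by
    intro a c p
    induction p with
    | nil => exact id
    | cons hab p ih =>
      refine fun ha => ih fun q => ?_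
      have := h.mem_touched_of_adj (ha (!q)) hab
      rwa [Bool.not_not] at this
  obtain ⟨p⟩ := hG.preconnected x v
  exact walk _ _ p (fun q => by cases q <;> assumption) false

theorem encard_sends_of_not_disjoint [Finite V] (hG : G.Connected) (h : M.IsExecution G) {x}
    (hx : x ∈ M.touched G false) (hx' : x ∈ M.touched G true) :
    {x : ℕ × V × V | M.sends G x.1 x.2.1 x.2.2}.encard = 2 * G.edgeSet.encard := by
  rw [h.encard_sends, ← encard_adj_eq_two_mul]
  congr 1
  ext p
  simp [h.touched_eq_univ hG hx hx']

/-- The degenerate case: an invocation without sends forces a one-node graph, where all counts are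
zero. -/
theorem encard_sends_of_not_sends [Finite V] (hG : G.Connected) (h : M.IsExecution G) {r v}
    (hi : M.invoked r v) (hno : ∀ r x y, ¬ M.sends G r x y) :
    {x : ℕ × V × V | M.sends G x.1 x.2.1 x.2.2}.encard = 0 ∧ G.edgeSet.encard = 0 := by
  constructor
  · rw [Set.encard_eq_zero]
    exact Set.eq_empty_of_forall_notMem fun x hx => hno _ _ _ hx
  · rw [Set.encard_eq_zero, SimpleGraph.edgeSet_eq_empty]
    have hv : ∀ w, ¬ G.Adj v w := fun w hvw => by
      obtain ⟨s, x, y, hs⟩ := h.exists_sends hi hvw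
      exact hno _ _ _ hs
    rcases subsingleton_or_nontrivial V with hV | hV
    · exact Subsingleton.elim _ _
    · obtain ⟨w, hw⟩ := hG.preconnected.exists_adj_of_nontrivial v
      exact absurd hw (hv w)

/-- The number of forwards, in general. -/
theorem encard_sends_cases [Finite V] (hG : G.Connected) (h : M.IsExecution G) {r v}
    (hi : M.invoked r v) :
    (G.IsBipartite ∧
      {x : ℕ × V × V | M.sends G x.1 x.2.1 x.2.2}.encard = G.edgeSet.encard) ∨
      {x : ℕ × V × V | M.sends G x.1 x.2.1 x.2.2}.encard = 2 * G.edgeSet.encard := by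
  classical
  by_cases hs : ∃ r x y, M.sends G r x y
  · obtain ⟨s, x, y, hs⟩ := hs
    by_cases hd : ∀ v ∈ M.touched G false, v ∉ M.touched G true
    · obtain ⟨hA, he⟩ := h.encard_sends_of_disjoint hG hs hd
      refine .inl ⟨?_, he⟩
      have c : G.Coloring Bool := SimpleGraph.Coloring.mk
        (fun v => decide (v ∈ M.touched G false)) (by
          intro v w hvw
          have := hA v w hvw
          by_cases hw : w ∈ M.touched G false <;> simp_all)
      exact c.colorable
    · push Not at hd
      obtain ⟨v, hv, hv'⟩ := hd
      exact .inr (h.encard_sends_of_not_disjoint hG hv hv')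
  · push Not at hs
    obtain ⟨h₁, h₂⟩ := h.encard_sends_of_not_sends hG hi hs
    exact .inr (by simp [h₁, h₂])

theorem entry_eq_none_or_of_not_sends (h : M.IsExecution G) {r}
    (hno : ∀ s < r, ∀ x y, ¬ M.sends G s x y) :
    (∀ s ≤ r, ∀ v, M.inbox s v = ∅) ∧
      ∀ s ≤ r, ∀ v q, M.entry s v q = none ∨ M.entry s v q = some ∅ := by
  have hbox : ∀ s ≤ r, ∀ v, M.inbox s v = ∅ := by
    rintro (_ | s) hs v
    · exact h.inbox_zero v
    · rw [h.inbox_succ]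
      exact Set.eq_empty_of_forall_notMem fun w hw => hno _ (by omega) _ _ hw
  refine ⟨hbox, fun s hs => ?_⟩
  induction s with
  | zero => exact fun v q => .inl (h.entry_zero v q)
  | succ s ih =>
    intro v q
    have ho : ∀ q, M.opened s v q = none ∨ M.opened s v q = some ∅ := by
      intro q
      unfold opened
      split_ifs
      exacts [.inr rfl, ih (by omega) v q]
    by_cases hne : M.entry (s + 1) v q = none
    · exact .inl hne
    rcases h.entry_succ_cases hne with ⟨-, he⟩ | ⟨-, he⟩
    · rw [he]
      have := hbox s (by omega) v
      simp only [ready, received, this, Set.not_nonempty_empty, if_false]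
      split_ifs
      exacts [.inl rfl, ho _]
    · rw [he]
      exact ho q

/-- With a single broadcaster, sends of a fixed round parity come from one side of a bipartition. -/
theorem sends_class (h : M.IsExecution G) {v₀ : V} (hv₀ : ∀ r v, M.invoked r v → v = v₀)
    {col : V → Bool} (hcol : ∀ v w, G.Adj v w → col w = !col v) :
    ∃ k, ∀ r v w, M.sends G r v w → (r.bodd ^^ col v) = k := by
  classical
  by_cases hex : ∃ r x y, M.sends G r x y
  swap
  · push Not at hex
    exact ⟨true, fun r v w hs => absurd hs (hex _ _ _)⟩
  set r₁ := Nat.find hex with hr₁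
  obtain ⟨x, y, hxy⟩ := Nat.find_spec hex
  rw [← hr₁] at hxy
  have hno : ∀ s < r₁, ∀ x y, ¬ M.sends G s x y := fun s hs x y hsxy =>
    Nat.find_min hex hs ⟨x, y, hsxy⟩
  obtain ⟨hbox, hent⟩ := h.entry_eq_none_or_of_not_sends hno
  have hother : ∀ v ≠ v₀, M.ready G r₁ v = none ∧ ∀ q, M.opened r₁ v q = none := by
    intro v hv
    have hi : ∀ s, ¬ M.invoked s v := fun s hs => hv (hv₀ s v hs)
    have he : ∀ q, M.entry r₁ v q = none :=
      h.entry_eq_none_of_fresh fun s hs => ⟨hi s, hbox s hs.le v⟩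
    exact ⟨ready_eq_none_of_fresh he (hi _) (hbox _ le_rfl v), fun q => by simp [opened, hi, he]⟩
  have hsender : ∀ v w, M.sends G r₁ v w → v = v₀ := by
    rintro v w ⟨-, -, L, hL, -⟩
    by_contra hv
    simp [(hother v hv).1] at hL
  obtain rfl := hsender x y hxy
  obtain ⟨s₀, hs₀, hinv⟩ : ∃ s ≤ r₁, M.invoked s x := by
    by_contra! hni
    exact h.not_sends_of_fresh (fun s hs => ⟨hni s hs, hbox s hs x⟩) hxy
  have hlate : ∀ r > r₁, ∀ v, ¬ M.invoked r v := by
    intro r hr v hi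
    obtain rfl := hv₀ r v hi
    exact (h.invoked_fresh r v hi s₀ (by omega)).1 hinv
  -- The crucial point: the first send clears its own entry and, as the other is still `⊥` or `∅`,
  -- the whole row. All tables are then empty, and only the messages in transit carry the broadcast
  -- on, in one component.
  have hentry : ∀ v q, M.entry (r₁ + 1) v q = none := by
    intro v q
    by_contra hne
    by_cases hv : v = x
    · subst hv
      have hq := h.entry_succ_cases hne
      have h₁ := h.entry_current r₁ v
      have h₂ := h.entry_other r₁ v
      simp only [hxy.1, if_true, true_and] at h₁ h₂
      rcases hq with ⟨rfl, -⟩ | ⟨rfl, -⟩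
      · exact hne h₁
      · have ho : M.opened r₁ v (!r₁.bodd) = none ∨ M.opened r₁ v (!r₁.bodd) = some ∅ := by
          unfold opened
          split_ifs
          exacts [.inr rfl, hent _ le_rfl v _]
        rcases ho with ho | ho <;> simp [ho] at h₂ <;> exact hne h₂
    · rcases h.entry_succ_cases hne with ⟨-, he⟩ | ⟨-, he⟩
      · exact hne (he.trans (hother v hv).1)
      · exact hne (he.trans ((hother v hv).2 q))
  set k := (r₁.bodd ^^ col x) with hk
  -- With no later invocations, a ready entry stems from an old entry or a reception. Each send
  -- flips both round parity and colour, so their `xor` is preserved.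
  have hready : ∀ r > r₁, (∀ v q, M.entry r v q ≠ none → (q ^^ col v) = k) →
      (∀ v, (M.inbox r v).Nonempty → (r.bodd ^^ col v) = k) →
      ∀ v, M.ready G r v ≠ none → (r.bodd ^^ col v) = k := by
    intro r hr he hb v hne
    by_cases hv : (M.inbox r v).Nonempty
    · exact hb v hv
    · refine he v _ fun hn => hne ?_
      simp [ready, received, opened, hv, hlate r hr, hn]
  have hinbox : ∀ r, (∀ v w, M.sends G r v w → (r.bodd ^^ col v) = k) →
      ∀ v, (M.inbox (r + 1) v).Nonempty → ((r + 1).bodd ^^ col v) = k := by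
    rintro r hs v ⟨w, hw⟩
    rw [h.inbox_succ] at hw
    have hw : M.sends G r w v := hw
    have := hs w v hw
    rw [hcol w v hw.adj, Nat.bodd_succ, ← this]
    simp
  have hfirst : ∀ v w, M.sends G r₁ v w → (r₁.bodd ^^ col v) = k := by
    intro v w hs
    rw [hsender v w hs]
  have main : ∀ r ≥ r₁ + 1, (∀ v q, M.entry r v q ≠ none → (q ^^ col v) = k) ∧
      ∀ v, (M.inbox r v).Nonempty → (r.bodd ^^ col v) = k := by
    intro r hr
    induction r, hr using Nat.le_induction with
    | base => exact ⟨fun v q hne => absurd (hentry v q) hne, hinbox _ hfirst⟩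
    | succ r hr ih =>
      have hrd := hready r (by omega) ih.1 ih.2
      refine ⟨fun v q hne => ?_, hinbox r fun v w hs => hrd v (h.ready_of_selected r v hs.1)⟩
      rcases h.entry_succ_cases hne with ⟨rfl, he⟩ | ⟨-, he⟩
      · exact hrd v (he ▸ hne)
      · rw [he] at hne
        exact ih.1 v q (by simpa [opened, hlate r (by omega)] using hne)
  refine ⟨k, fun r v w hs => ?_⟩
  rcases lt_trichotomy r r₁ with hr | rfl | hr
  · exact absurd hs (hno r hr v w)
  · exact hfirst v w hs
  · exact hready r hr (main r hr).1 (main r hr).2 v (h.ready_of_selected r v hs.1)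

theorem encard_sends_of_single [Finite V] (hG : G.Connected) (hbip : G.IsBipartite)
    (h : M.IsExecution G) {r v₀} (hi : M.invoked r v₀) (hv₀ : ∀ r v, M.invoked r v → v = v₀) :
    {x : ℕ × V × V | M.sends G x.1 x.2.1 x.2.2}.encard = G.edgeSet.encard := by
  classical
  by_cases hs : ∃ r x y, M.sends G r x y
  · obtain ⟨s, x, y, hs⟩ := hs
    obtain ⟨c⟩ := hbip
    obtain ⟨k, hk⟩ := h.sends_class hv₀ (col := fun v => decide (c v = 0)) (by
      intro v w hvw
      have := c.valid hvw
      revert this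
      generalize c v = a
      generalize c w = b
      decide +revert)
    have key : ∀ q v, v ∈ M.touched G q → (q ^^ decide (c v = 0)) = k := by
      rintro q v ⟨s, w, t, -, ⟨ht, hs⟩ | ⟨ht, hs⟩⟩
      · rw [← hk _ _ _ hs, ht]
      · have hne := c.valid hs.adj
        rw [← hk _ _ _ hs, ht]
        revert hne
        generalize c v = a
        generalize c w = b
        clear * -
        revert q a b
        decide
    refine (h.encard_sends_of_disjoint hG hs fun v hv hv' => ?_).2
    have := (key _ _ hv).trans (key _ _ hv').symm
    simp at this
  · push Not at hs
    obtain ⟨h₁, h₂⟩ := h.encard_sends_of_not_sends hG hi hs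
    rw [h₁, h₂]

end IsExecution

end MessageTrace

/-! ### From executions of the algorithm to single-message histories -/

section Bridge

variable {Msg : Type*} (G)
variable (par : V → Bool) (B : ℕ → V → Set Msg) (S : ℕ → V → Finset Msg)

/-- The history of the message `m` in an execution. -/
noncomputable def traceOf (m : Msg) : MessageTrace V where
  entry r v q := ((run G par B S r).node v).messTbl m (par v ^^ q)
  inbox r v := {w | (run G par B S r).sent w v m}
  invoked r v := m ∈ B r v
  selected r v := m ∈ S r v

variable {G par B S}

/-- A node's flag always differs from the round parity by its initial value. The shift by `par v` in
`traceOf` thus aligns all columns with the global round parity, and the arbitrary initial flags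
disappear. -/
theorem parity_run (r : ℕ) (v : V) : ((run G par B S r).node v).parity = (par v ^^ r.bodd) := by
  induction r with
  | zero => simp [run]
  | succ r ih => simp [run, step, ih]

theorem invoke_run (r : ℕ) (v : V) (m : Msg) (q : Bool) :
    ((run G par B S r).node v).messTbl.invoke (B r v) m (par v ^^ q) =
      (traceOf G par B S m).opened r v q := rfl

theorem readyTable_run_current (r : ℕ) (v : V) (m : Msg) :
    readyTable G (run G par B S r) (B r v) v m ((run G par B S r).node v).parity =
      (traceOf G par B S m).ready G r v := by
  have hr : (((run G par B S r).node v).messTbl.invoke (B r v)).receive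
      ((run G par B S r).node v).parity (fun m => {w | (run G par B S r).sent w v m}) m
      ((run G par B S r).node v).parity = (traceOf G par B S m).received r v := by
    unfold Table.receive MessageTrace.received
    rw [parity_run, invoke_run]
    refine @if_congr _ _ _ (_) (_) _ _ _ _ ?_ rfl rfl
    exact ⟨fun h => h.2, fun h => ⟨rfl, h⟩⟩
  simp only [readyTable, Table.clean, MessageTrace.ready, true_and, hr]

theorem readyTable_run_other (r : ℕ) (v : V) (m : Msg) :
    readyTable G (run G par B S r) (B r v) v m (par v ^^ !r.bodd) =
      (traceOf G par B S m).opened r v (!r.bodd) := by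
  have hp : (par v ^^ !r.bodd) ≠ ((run G par B S r).node v).parity := by
    rw [parity_run]
    cases par v <;> cases r.bodd <;> simp
  simp only [readyTable, Table.clean, Table.receive, hp, false_and, if_false]
  exact invoke_run r v m _

theorem sendsAt_iff {r v w} {m : Msg} :
    sendsAt G par B S r v w m ↔ (traceOf G par B S m).sends G r v w := by
  unfold sendsAt sendsIn MessageTrace.sends
  rw [readyTable_run_current]
  rfl

theorem mem_eligibleAt_iff {r v} {m : Msg} :
    m ∈ eligibleAt G par B S r v ↔ (traceOf G par B S m).ready G r v ≠ none := by
  unfold eligibleAt eligible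
  rw [← readyTable_run_current]
  rfl

theorem receivesAt_iff {r v} {m : Msg} :
    receivesAt G par B S r v m ↔ ((traceOf G par B S m).inbox r v).Nonempty := Iff.rfl

theorem exists_selected_or_not_eligible {b : ℕ} (hb : 1 ≤ b) (hS : IsSelection G par B S b)
    (hfair : IsFair G par B S) (m : Msg) (r : ℕ) (v : V) :
    ∃ j, m ∈ S (r + 2 * j) v ∨ m ∉ eligibleAt G par B S (r + 2 * j) v := by
  obtain ⟨K, hK⟩ := hfair
  by_contra! hno
  -- The `K + 1` rounds `j = 0, …, K` each contain at least one selection, by maximality and `1 ≤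
  -- b`, exceeding the bound `K`.
  have hle := hK v m r K fun j _ => ⟨(hno j).2, (hno j).1⟩
  have hone : ∀ j ∈ Finset.range (K + 1), 1 ≤ (S (r + 2 * j) v).card := by
    intro j _
    by_contra hlt
    exact (hno j).1 (hS.maximal _ _ (by omega) (hno j).2)
  have := Finset.card_nsmul_le_sum _ _ _ hone
  simp only [Finset.card_range, smul_eq_mul, mul_one] at this
  omega

theorem isExecution_traceOf {b : ℕ} (hb : 1 ≤ b) (hB : InvokedBeforeReached G par B S)
    (hS : IsSelection G par B S b) (hfair : IsFair G par B S) (m : Msg) :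
    (traceOf G par B S m).IsExecution G where
  entry_zero v q := rfl
  inbox_zero v := by ext; simp [traceOf, run]
  entry_current r v := by
    rw [← readyTable_run_current, parity_run]
    change Table.discard _ ((run G par B S r).node v).parity _ _ _ = _
    rw [parity_run]
    refine @if_congr _ _ _ (_) (_) _ _ _ _ ?_ rfl rfl
    exact ⟨fun h => h.1, fun h => ⟨h, .inl rfl⟩⟩
  entry_other r v := by
    rw [← readyTable_run_other]
    have hp : (par v ^^ !r.bodd) ≠ (par v ^^ r.bodd) := by
      cases par v <;> cases r.bodd <;> simp
    change Table.discard _ ((run G par B S r).node v).parity _ _ _ = _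
    rw [parity_run]
    refine @if_congr _ _ _ (_) (_) _ _ _ _ ?_ rfl rfl
    exact ⟨fun h => ⟨h.1, h.2.resolve_left hp⟩, fun h => ⟨h.1, .inr h.2⟩⟩
  inbox_succ r v := by
    ext w
    exact sendsAt_iff
  ready_of_selected r v hs := mem_eligibleAt_iff.mp (hS.subset r v hs)
  invoked_fresh r v hi s hs := by
    obtain ⟨h₁, h₂⟩ := hB m v r hi s hs
    exact ⟨h₁, Set.not_nonempty_iff_eq_empty.mp (receivesAt_iff.not.mp h₂)⟩
  progress r v := by
    obtain ⟨j, hj | hj⟩ := exists_selected_or_not_eligible hb hS hfair m r v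
    · exact ⟨j, .inl hj⟩
    · exact ⟨j, .inr (by simpa [mem_eligibleAt_iff] using hj)⟩

theorem forwardCount_eq (m : Msg) : forwardCount G par B S m =
    {x : ℕ × V × V | (traceOf G par B S m).sends G x.1 x.2.1 x.2.2}.encard := by
  simp only [forwardCount, sendsAt_iff]

theorem quietFrom_iff {T : ℕ} {m : Msg} : QuietFrom G par B S T m ↔
    ∀ r ≥ T, ∀ v, (∀ w, ¬ (traceOf G par B S m).sends G r v w) ∧
      (traceOf G par B S m).inbox r v = ∅ ∧ ∀ q, (traceOf G par B S m).entry r v q = none := by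
  have htbl : ∀ r v, (∀ q, ((run G par B S r).node v).messTbl m q = none) ↔
      ∀ q, (traceOf G par B S m).entry r v q = none := by
    intro r v
    refine ⟨fun h q => h _, fun h q => ?_⟩
    have : ((run G par B S r).node v).messTbl m (par v ^^ (par v ^^ q)) = none := h (par v ^^ q)
    simpa using this
  simp only [QuietFrom, sendsAt_iff, receivesAt_iff, htbl, Set.not_nonempty_iff_eq_empty]

theorem QuietFrom.mono {T T' : ℕ} {m : Msg} (h : QuietFrom G par B S T m) (hT : T ≤ T') :
    QuietFrom G par B S T' m := fun r hr => h r (hT.trans hr)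

theorem MessageTrace.IsExecution.quiet_of_not_invoked {M : MessageTrace V} (h : M.IsExecution G)
    (hi : ∀ r v, ¬ M.invoked r v) (r : ℕ) :
    ∀ v, (∀ w, ¬ M.sends G r v w) ∧ M.inbox r v = ∅ ∧ ∀ q, M.entry r v q = none := by
  have hbox : ∀ r, ∀ s ≤ r, ∀ v, M.inbox s v = ∅ := by
    intro r
    induction r with
    | zero =>
      intro s hs v
      obtain rfl : s = 0 := by omega
      exact h.inbox_zero v
    | succ r ih =>
      intro s hs v
      rcases Nat.le_succ_iff.mp hs with hs | rfl
      · exact ih s hs v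
      · rw [h.inbox_succ]
        exact Set.eq_empty_of_forall_notMem fun w hw =>
          h.not_sends_of_fresh (fun s hs => ⟨hi s w, ih s hs w⟩) hw
  intro v
  have hf : ∀ s, ¬ M.invoked s v ∧ M.inbox s v = ∅ := fun s => ⟨hi s v, hbox s s le_rfl v⟩
  exact ⟨fun w => h.not_sends_of_fresh fun s _ => hf s, (hf r).2,
    h.entry_eq_none_of_fresh fun s _ => hf s⟩

end Bridge

end AmnesiacFlooding

theorem mainTheorem2 {V Msg : Type*} [Finite V] (G : SimpleGraph V) (hG : G.Connected)
    (b : ℕ) (hb : 1 ≤ b)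
    (par : V → Bool) (B : ℕ → V → Set Msg) (S : ℕ → V → Finset Msg)
    (hB : AmnesiacFlooding.InvokedBeforeReached G par B S)
    (hS : AmnesiacFlooding.IsSelection G par B S b)
    (hfair : AmnesiacFlooding.IsFair G par B S) :
    (∀ m : Msg, (∃ r v, m ∈ B r v) →
      (∃ T, AmnesiacFlooding.QuietFrom G par B S T m) ∧
      AmnesiacFlooding.Delivered G par B S m ∧
      (¬ G.IsBipartite →
        AmnesiacFlooding.forwardCount G par B S m = 2 * G.edgeSet.encard) ∧
      (G.IsBipartite →
        (AmnesiacFlooding.forwardCount G par B S m = G.edgeSet.encard ∨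
          AmnesiacFlooding.forwardCount G par B S m = 2 * G.edgeSet.encard) ∧
        ((∀ v w r s, m ∈ B r v → m ∈ B s w → v = w) →
          AmnesiacFlooding.forwardCount G par B S m = G.edgeSet.encard))) ∧
    ({x : ℕ × V × Msg | x.2.2 ∈ B x.1 x.2.1}.Finite →
      ∃ T, ∀ m : Msg, AmnesiacFlooding.QuietFrom G par B S T m) := by
  have hex := AmnesiacFlooding.isExecution_traceOf hb hB hS hfair
  have hquiet : ∀ m, ∃ T, AmnesiacFlooding.QuietFrom G par B S T m := fun m => by
    obtain ⟨T, hT⟩ := (hex m).exists_quiet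
    exact ⟨T, AmnesiacFlooding.quietFrom_iff.mpr hT⟩
  refine ⟨?_, fun hfin => ?_⟩
  · rintro m ⟨r, v, hm⟩
    rw [AmnesiacFlooding.forwardCount_eq]
    have hcases := (hex m).encard_sends_cases hG (r := r) (v := v) hm
    refine ⟨hquiet m, ?_, fun hnb => hcases.resolve_left fun h => hnb h.1,
      fun hbip => ⟨hcases.imp_left And.right, fun hone => ?_⟩⟩
    · exact fun u hu => (hex m).exists_inbox_nonempty hG (r := r) (x := v) hm hu
    · exact (hex m).encard_sends_of_single hG hbip (r := r) (v₀ := v) hm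
        fun s w hs => hone w v s r hs hm
  · choose T hT using hquiet
    -- Finitely many broadcasts give a common bound; messages never broadcast are quiet from the
    -- start.
    obtain ⟨T₀, hT₀⟩ := (hfin.image fun x => T x.2.2).bddAbove
    refine ⟨T₀, fun m => ?_⟩
    by_cases hm : ∃ r v, m ∈ B r v
    · obtain ⟨r, v, hm⟩ := hm
      exact (hT m).mono (hT₀ ⟨(r, v, m), hm, rfl⟩)
    · push Not at hm
      exact AmnesiacFlooding.quietFrom_iff.mpr fun r _ => (hex m).quiet_of_not_invoked hm r
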